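/- Let $(M,g)$ be a 3-dimensional smooth Riemannian manifold with a contact metric structure $(\phi,\xi,\eta,g)$: $\phi$ is a smooth $(1,1)$-tensor field, $\xi$ a smooth vector field and $\eta$ a smooth 1-form with $$\eta(\xi)=1,\qquad \phi^2X=-X+\eta(X)\xi,\qquad g(\phi X,\phi Y)=g(X,Y)-\eta(X)\eta(Y),\qquad d\eta(X,Y)=g(X,\phi Y),$$ where $d\eta(X,Y)=\tfrac12\big(X\eta(Y)-Y\eta(X)-\eta([X,Y])\big)$. Let $h=\tfrac12 L_\xi\phi$, that is, $hX=\tfrac12\big([\xi,\phi X]-\phi[\xi,X]\big)$; let $R(X,Y)Z=\nabla_X\nabla_YZ-\nabla_Y\nabla_XZ-\nabla_{[X,Y]}Z$ be the Riemann curvature tensor of the Levi-Civita connection $\nabla$ of $g$, let $Q$ be the Ricci operator, $QX=\sum_i R(X,e_i)e_i$ for a local orthonormal frame $(e_i)$, and let $\tau=\operatorname{tr}Q$ be the scalar curvature. Suppose that $M$ is a $(\kappa,\mu,\nu)$-contact metric manifold, i.e. there are smooth functions $\kappa,\mu,\nu$ on $M$ such that for all vector fields $X,Y$ $$R(X,Y)\xi=\kappa\{\eta(Y)X-\eta(X)Y\}+\mu\{\eta(Y)hX-\eta(X)hY\}+\nu\{\eta(Y)\phi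 hX-\eta(X)\phi hY\},$$ and suppose that $\kappa<1$ everywhere on $M$. Then $$R=\Big(\frac{\tau}{2}-2\kappa\Big)R_1+\Big(\frac{\tau}{2}-3\kappa\Big)R_3+\mu R_4+\nu R_7,$$ where, for all vector fields $X,Y,Z$ on $M$, $$\begin{aligned} R_1(X,Y)Z&=g(Y,Z)X-g(X,Z)Y,\\ R_3(X,Y)Z&=\eta(X)\eta(Z)Y-\eta(Y)\eta(Z)X+g(X,Z)\eta(Y)\xi-g(Y,Z)\eta(X)\xi,\\ R_4(X,Y)Z&=g(Y,Z)hX-g(X,Z)hY+g(hY,Z)X-g(hX,Z)Y,\\ R_7(X,Y)Z&=g(Y,Z)\phi hX-g(X,Z)\phi hY+g(\phi hY,Z)X-g(\phi hX,Z)Y. \end{aligned}$$ -/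

import Mathlib

open Bundle Manifold VectorField
open scoped ContDiff

noncomputable section

/-- Smoothness (of class `C^∞`) of a vector field. -/
def SmoothVF {n : ℕ} {M : Type*} [TopologicalSpace M]
    [ChartedSpace (EuclideanSpace ℝ (Fin n)) M] [IsManifold (𝓡 n) ∞ M]
    (X : Π x : M, TangentSpace (𝓡 n) x) : Prop :=
  ContMDiff (𝓡 n) (𝓡 n).tangent ∞ (fun x ↦ (⟨x, X x⟩ : TangentBundle (𝓡 n) M))

/-- The derivative `X f` of a real function `f` along a vector field `X`. -/
def dirDeriv {n : ℕ} {M : Type*} [TopologicalSpace M]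
    [ChartedSpace (EuclideanSpace ℝ (Fin n)) M]
    (X : Π x : M, TangentSpace (𝓡 n) x) (f : M → ℝ) (x : M) : ℝ :=
  mvfderiv (𝓡 n) f x (X x)

section Riemannian

/-- A vector field that is smooth near `x` and has the value `v` at `x` (its components are constant
in the trivialization of the tangent bundle at `x`). -/
def extVF {n : ℕ} {M : Type*} [TopologicalSpace M]
    [ChartedSpace (EuclideanSpace ℝ (Fin n)) M] [IsManifold (𝓡 n) ∞ M]
    {x : M} (v : TangentSpace (𝓡 n) x) : Π y : M, TangentSpace (𝓡 n) y :=
  FiberBundle.extend (EuclideanSpace ℝ (Fin n)) (E := fun y : M ↦ TangentSpace (𝓡 n) y) v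

instance {n : ℕ} {M : Type*} [TopologicalSpace M]
    [ChartedSpace (EuclideanSpace ℝ (Fin n)) M] (x : M) :
    FiniteDimensional ℝ (TangentSpace (𝓡 n) x) :=
  inferInstanceAs (FiniteDimensional ℝ (EuclideanSpace ℝ (Fin n)))

variable {n : ℕ} {M : Type*} [TopologicalSpace M]
  [ChartedSpace (EuclideanSpace ℝ (Fin n)) M] [IsManifold (𝓡 n) ∞ M]
  [RiemannianBundle (fun x : M ↦ TangentSpace (𝓡 n) x)]

/-- An orthonormal basis of the tangent space at `x`. -/
def onb (x : M) :
    OrthonormalBasis (Fin (Module.finrank ℝ (TangentSpace (𝓡 n) x))) ℝ (TangentSpace (𝓡 n) x) :=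
  stdOrthonormalBasis ℝ (TangentSpace (𝓡 n) x)

/-- The right-hand side of the Koszul formula: for the Levi-Civita connection `∇`,
it is `g(∇_X Y, Z)`. -/
def koszul (X Y Z : Π x : M, TangentSpace (𝓡 n) x) (x : M) : ℝ :=
  (1 / 2 : ℝ) *
    (dirDeriv X (fun y ↦ inner ℝ (Y y) (Z y)) x
      + dirDeriv Y (fun y ↦ inner ℝ (Z y) (X y)) x
      - dirDeriv Z (fun y ↦ inner ℝ (X y) (Y y)) x
      + inner ℝ (mlieBracket (𝓡 n) X Y x) (Z x)
      - inner ℝ (mlieBracket (𝓡 n) Y Z x) (X x)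
      + inner ℝ (mlieBracket (𝓡 n) Z X x) (Y x))

/-- The Levi-Civita connection `∇_X Y`: the vector at `x` whose inner product with a vector `z`
is given by the Koszul formula (written out in an orthonormal basis; the Koszul expression at `x`
depends only on the value of `Z` at `x`). -/
def leviCivita (X Y : Π x : M, TangentSpace (𝓡 n) x) (x : M) : TangentSpace (𝓡 n) x :=
  ∑ i, koszul X Y (extVF (onb x i)) x • onb x i

/-- The Riemann curvature tensor
`R(X,Y)Z = ∇_X ∇_Y Z - ∇_Y ∇_X Z - ∇_[X,Y] Z`. -/
def riemann (X Y Z : Π x : M, TangentSpace (𝓡 n) x) (x : M) : TangentSpace (𝓡 n) x :=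
  leviCivita X (leviCivita Y Z) x - leviCivita Y (leviCivita X Z) x
    - leviCivita (mlieBracket (𝓡 n) X Y) Z x

/-- The Ricci operator `Q v = ∑ i, R(v, e_i) e_i`, for an orthonormal basis `e_i`
of the tangent space. -/
def ricciOp (x : M) (v : TangentSpace (𝓡 n) x) : TangentSpace (𝓡 n) x :=
  ∑ i, riemann (extVF v) (extVF (onb x i)) (extVF (onb x i)) x

/-- The scalar curvature `τ = tr Q`. -/
def scalarCurv (n : ℕ) {M : Type*} [TopologicalSpace M]
    [ChartedSpace (EuclideanSpace ℝ (Fin n)) M] [IsManifold (𝓡 n) ∞ M]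
    [RiemannianBundle (fun x : M ↦ TangentSpace (𝓡 n) x)] (x : M) : ℝ :=
  ∑ i, inner ℝ (ricciOp x (onb (n := n) x i)) (onb x i)

end Riemannian

/-- An almost contact metric structure `(φ, ξ, η)` on a Riemannian manifold `(M, g)`, where `g` is
the inner product of the tangent spaces. -/
structure AlmostContactMetric (n : ℕ) (M : Type*) [TopologicalSpace M]
    [ChartedSpace (EuclideanSpace ℝ (Fin n)) M] [IsManifold (𝓡 n) ∞ M]
    [RiemannianBundle (fun x : M ↦ TangentSpace (𝓡 n) x)] where
  /-- the `(1,1)`-tensor field `φ` -/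
  φ : Π x : M, TangentSpace (𝓡 n) x →L[ℝ] TangentSpace (𝓡 n) x
  /-- the structure vector field `ξ` -/
  ξ : Π x : M, TangentSpace (𝓡 n) x
  /-- the `1`-form `η` -/
  η : Π x : M, TangentSpace (𝓡 n) x →L[ℝ] ℝ
  smooth_φ : ContMDiff (𝓡 n)
    ((𝓡 n).prod 𝓘(ℝ, EuclideanSpace ℝ (Fin n) →L[ℝ] EuclideanSpace ℝ (Fin n))) ∞
    (fun x ↦ TotalSpace.mk' (EuclideanSpace ℝ (Fin n) →L[ℝ] EuclideanSpace ℝ (Fin n))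
      (E := fun x : M ↦ (TangentSpace (𝓡 n) x →L[ℝ] TangentSpace (𝓡 n) x)) x (φ x))
  smooth_ξ : SmoothVF ξ
  smooth_η : ContMDiff (𝓡 n)
    ((𝓡 n).prod 𝓘(ℝ, EuclideanSpace ℝ (Fin n) →L[ℝ] ℝ)) ∞
    (fun x ↦ TotalSpace.mk' (EuclideanSpace ℝ (Fin n) →L[ℝ] ℝ)
      (E := fun x : M ↦ (TangentSpace (𝓡 n) x →L[ℝ] Trivial M ℝ x)) x (η x))
  η_ξ : ∀ x, η x (ξ x) = 1
  φ_φ : ∀ x v, φ x (φ x v) = -v + η x v • ξ x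
  inner_φ_φ : ∀ x v w, inner ℝ (φ x v) (φ x w) = inner ℝ v w - η x v * η x w

namespace AlmostContactMetric

variable {n : ℕ} {M : Type*} [TopologicalSpace M]
  [ChartedSpace (EuclideanSpace ℝ (Fin n)) M] [IsManifold (𝓡 n) ∞ M]
  [RiemannianBundle (fun x : M ↦ TangentSpace (𝓡 n) x)] (S : AlmostContactMetric n M)

/-- The vector field `φX`. -/
def φF (X : Π x : M, TangentSpace (𝓡 n) x) (x : M) : TangentSpace (𝓡 n) x := S.φ x (X x)

/-- The function `η(X)`. -/
def ηF (X : Π x : M, TangentSpace (𝓡 n) x) (x : M) : ℝ := S.η x (X x)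

/-- The exterior derivative of `η`, in the convention
`dη(X,Y) = (1/2) (X η(Y) - Y η(X) - η([X,Y]))` of contact metric geometry. -/
def dη (X Y : Π x : M, TangentSpace (𝓡 n) x) (x : M) : ℝ :=
  (1 / 2 : ℝ) * (dirDeriv X (S.ηF Y) x - dirDeriv Y (S.ηF X) x
    - S.ηF (mlieBracket (𝓡 n) X Y) x)

/-- The structure is a contact metric structure: `dη = Φ`, where `Φ(X,Y) = g(X, φY)`. -/
def IsContactMetric : Prop :=
  ∀ X Y : Π x : M, TangentSpace (𝓡 n) x, SmoothVF X → SmoothVF Y →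
    ∀ x, S.dη X Y x = inner ℝ (X x) (S.φF Y x)

/-- The tensor `h = (1/2) L_ξ φ`, where `(L_ξ φ) X = [ξ, φX] - φ[ξ, X]`. -/
def h (X : Π x : M, TangentSpace (𝓡 n) x) (x : M) : TangentSpace (𝓡 n) x :=
  (1 / 2 : ℝ) • (mlieBracket (𝓡 n) S.ξ (S.φF X) x - S.φ x (mlieBracket (𝓡 n) S.ξ X x))

/-- A `(κ,μ,ν)`-contact metric manifold: `κ`, `μ`, `ν` are smooth functions and
`R(X,Y)ξ = κ{η(Y)X - η(X)Y} + μ{η(Y)hX - η(X)hY} + ν{η(Y)φhX - η(X)φhY}`. -/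
structure IsKappaMuNu (κ μ ν : M → ℝ) : Prop where
  contact : S.IsContactMetric
  smooth_κ : ContMDiff (𝓡 n) 𝓘(ℝ, ℝ) ∞ κ
  smooth_μ : ContMDiff (𝓡 n) 𝓘(ℝ, ℝ) ∞ μ
  smooth_ν : ContMDiff (𝓡 n) 𝓘(ℝ, ℝ) ∞ ν
  riemann_ξ : ∀ X Y : Π x : M, TangentSpace (𝓡 n) x, SmoothVF X → SmoothVF Y → ∀ x,
    riemann X Y S.ξ x =
      κ x • (S.ηF Y x • X x - S.ηF X x • Y x)
      + μ x • (S.ηF Y x • S.h X x - S.ηF X x • S.h Y x)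
      + ν x • (S.ηF Y x • S.φF (S.h X) x - S.ηF X x • S.φF (S.h Y) x)

/-- `R₁(X,Y)Z = g(Y,Z)X - g(X,Z)Y` -/
def R₁ (X Y Z : Π x : M, TangentSpace (𝓡 n) x) (x : M) : TangentSpace (𝓡 n) x :=
  (inner ℝ (Y x) (Z x) : ℝ) • X x - (inner ℝ (X x) (Z x) : ℝ) • Y x

/-- `R₃(X,Y)Z = η(X)η(Z)Y - η(Y)η(Z)X + g(X,Z)η(Y)ξ - g(Y,Z)η(X)ξ` -/
def R₃ (X Y Z : Π x : M, TangentSpace (𝓡 n) x) (x : M) : TangentSpace (𝓡 n) x :=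
  (S.ηF X x * S.ηF Z x) • Y x - (S.ηF Y x * S.ηF Z x) • X x
    + (inner ℝ (X x) (Z x) * S.ηF Y x : ℝ) • S.ξ x
    - (inner ℝ (Y x) (Z x) * S.ηF X x : ℝ) • S.ξ x

/-- `R₄(X,Y)Z = g(Y,Z)hX - g(X,Z)hY + g(hY,Z)X - g(hX,Z)Y` -/
def R₄ (X Y Z : Π x : M, TangentSpace (𝓡 n) x) (x : M) : TangentSpace (𝓡 n) x :=
  (inner ℝ (Y x) (Z x) : ℝ) • S.h X x - (inner ℝ (X x) (Z x) : ℝ) • S.h Y x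
    + (inner ℝ (S.h Y x) (Z x) : ℝ) • X x - (inner ℝ (S.h X x) (Z x) : ℝ) • Y x

/-- `R₇(X,Y)Z = g(Y,Z)φhX - g(X,Z)φhY + g(φhY,Z)X - g(φhX,Z)Y` -/
def R₇ (X Y Z : Π x : M, TangentSpace (𝓡 n) x) (x : M) : TangentSpace (𝓡 n) x :=
  (inner ℝ (Y x) (Z x) : ℝ) • S.φF (S.h X) x - (inner ℝ (X x) (Z x) : ℝ) • S.φF (S.h Y) x
    + (inner ℝ (S.φF (S.h Y) x) (Z x) : ℝ) • X x
    - (inner ℝ (S.φF (S.h X) x) (Z x) : ℝ) • Y x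

end AlmostContactMetric

end

/-! The identity is pointwise linear algebra once the symmetries of `riemann` and of h are known. In
dimension 3, a form R(a,b,c,d) that is antisymmetric in each pair, symmetric under exchange of the
pairs and zero whenever c = ξ, for a unit vector ξ, lives on the single plane orthogonal to ξ. It is
therefore one number times the square of the area form of that plane, and the number is minus half
the scalar curvature (`IsCurvatureLike.eq_zero`). Hence a curvature tensor is determined by R(·,·)ξ
and by τ, and it suffices that both sides have the same values there (`IsCurvatureLike.eq_of_reeb`).
On ξ the tensors R₁ and R₃ are opposite, so their coefficients must differ by κ; their scalar
curvatures are 6 and -4, which fixes the coefficients.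

For R₄ and R₇ to be curvature-like, to reproduce the μ and ν terms at ξ and to have no scalar
curvature, h and φh must be symmetric, trace-free and zero on ξ. Symmetry comes from L_ξ η = 0,
hence L_ξ dη = 0 (`dirDeriv_ξ_inner_φF`); the traces vanish because h anticommutes with φ.

The rest is the Riemannian background for a connection defined by the Koszul formula:
torsion-freeness, metric compatibility, smoothness of ∇_X Y, and the symmetries and tensoriality of
the curvature. -/

open Filter Topology

set_option linter.unusedSectionVars false

/-! ### Smooth vector fields and extension of tangent vectors -/

section SmoothFields

variable {n : ℕ} {M : Type*} [TopologicalSpace M]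
  [ChartedSpace (EuclideanSpace ℝ (Fin n)) M] [IsManifold (𝓡 n) ∞ M]
  {X Y Z : Π x : M, TangentSpace (𝓡 n) x} {f g : M → ℝ} {x : M}

lemma SmoothVF.mdifferentiableAt (hX : SmoothVF X) (x : M) : MDifferentiableAt (𝓡 n) (𝓡 n).tangent (fun y ↦ (⟨y, X y⟩ : TangentBundle (𝓡 n) M)) x :=
  (hX x).mdifferentiableAt (by simp)

lemma SmoothVF.add (hX : SmoothVF X) (hY : SmoothVF Y) : SmoothVF (X + Y) :=
  ContMDiff.add_section hX hY

lemma SmoothVF.sub (hX : SmoothVF X) (hY : SmoothVF Y) : SmoothVF (X - Y) :=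
  ContMDiff.sub_section hX hY

lemma SmoothVF.smul (hf : ContMDiff (𝓡 n) 𝓘(ℝ, ℝ) ∞ f) (hX : SmoothVF X) : SmoothVF (f • X) :=
  ContMDiff.smul_section hf hX

lemma SmoothVF.const_smul (c : ℝ) (hX : SmoothVF X) : SmoothVF (c • X) :=
  ContMDiff.const_smul_section hX

lemma SmoothVF.mlieBracket (hX : SmoothVF X) (hY : SmoothVF Y) :
    SmoothVF (mlieBracket (𝓡 n) X Y) := by
  have : IsManifold (𝓡 n) (((⊤ : ℕ∞) : WithTop ℕ∞) + 1) M := by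
    simpa using (inferInstance : IsManifold (𝓡 n) ∞ M)
  have : IsManifold (𝓡 n) (minSmoothness ℝ 2) M := by
    simpa using (inferInstance : IsManifold (𝓡 n) 2 M)
  exact ContDiff.mlieBracket_vectorField (m := ⊤) (n := ⊤) hX hY (by simp)

lemma SmoothVF.dirDeriv (hX : SmoothVF X) (hf : ContMDiff (𝓡 n) 𝓘(ℝ, ℝ) ∞ f) :
    ContMDiff (𝓡 n) 𝓘(ℝ, ℝ) ∞ (dirDeriv X f) := by
  have h1 : ContMDiff (𝓡 n).tangent 𝓘(ℝ, ℝ).tangent ∞ (tangentMap (𝓡 n) 𝓘(ℝ, ℝ) f) :=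
    hf.contMDiff_tangentMap (by simp)
  exact (contMDiff_snd_tangentBundle_modelSpace ℝ 𝓘(ℝ, ℝ)).comp (h1.comp hX)

/-- `extVF v` is smooth only near x; multiplying it by a bump function gives a global smooth field
with the same germ, so results on smooth fields apply to the local definitions of curvature. -/
lemma exists_smoothVF_eventuallyEq [T2Space M] {x : M} (v : TangentSpace (𝓡 n) x) :
    ∃ V : Π y : M, TangentSpace (𝓡 n) y, SmoothVF V ∧ V =ᶠ[𝓝 x] extVF v := by
  obtain ⟨s, hs, hsv⟩ := FiberBundle.exists_contMDiffOn_extend (k := ∞) (𝓡 n)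
    (EuclideanSpace ℝ (Fin n)) (V := fun y : M ↦ TangentSpace (𝓡 n) y) v
  obtain ⟨b, -, hb⟩ := (SmoothBumpFunction.nhds_basis_tsupport (I := 𝓡 n) x).mem_iff.1
    (interior_mem_nhds.2 hs)
  refine ⟨(b : M → ℝ) • extVF v, ContMDiffOn.smul_section_of_tsupport (u := interior s)
    b.contMDiff.contMDiffOn isOpen_interior hb (hsv.mono interior_subset), ?_⟩
  filter_upwards [b.eventuallyEq_one] with y hy
  simp only [Pi.smul_apply', hy, Pi.one_apply, one_smul]
  rfl

lemma extVF_self (v : TangentSpace (𝓡 n) x) : extVF v x = v := by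
  simp [extVF]

lemma exists_smoothVF_eq [T2Space M] {x : M} (v : TangentSpace (𝓡 n) x) :
    ∃ V : Π y : M, TangentSpace (𝓡 n) y, SmoothVF V ∧ V x = v := by
  obtain ⟨V, hV, hVv⟩ := exists_smoothVF_eventuallyEq v
  exact ⟨V, hV, by rw [hVv.self_of_nhds, extVF_self]⟩

end SmoothFields

/-! ### Derivations and the Lie bracket -/

section DirDeriv

variable {n : ℕ} {M : Type*} [TopologicalSpace M]
  [ChartedSpace (EuclideanSpace ℝ (Fin n)) M]
  {X Y Z : Π x : M, TangentSpace (𝓡 n) x} {f g : M → ℝ} {x : M}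

lemma dirDeriv_add (hf : MDifferentiableAt (𝓡 n) 𝓘(ℝ, ℝ) f x) (hg : MDifferentiableAt (𝓡 n) 𝓘(ℝ, ℝ) g x) :
    dirDeriv X (fun y ↦ f y + g y) x = dirDeriv X f x + dirDeriv X g x := by
  simp [dirDeriv, mvfderiv_fun_add hf hg]

lemma dirDeriv_sub (hf : MDifferentiableAt (𝓡 n) 𝓘(ℝ, ℝ) f x) (hg : MDifferentiableAt (𝓡 n) 𝓘(ℝ, ℝ) g x) :
    dirDeriv X (fun y ↦ f y - g y) x = dirDeriv X f x - dirDeriv X g x := by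
  simp [dirDeriv, mvfderiv_fun_sub hf hg]

lemma dirDeriv_mul (hf : MDifferentiableAt (𝓡 n) 𝓘(ℝ, ℝ) f x) (hg : MDifferentiableAt (𝓡 n) 𝓘(ℝ, ℝ) g x) :
    dirDeriv X (fun y ↦ f y * g y) x = f x * dirDeriv X g x + g x * dirDeriv X f x := by
  simp [dirDeriv, mvfderiv_fun_mul hf hg]

lemma dirDeriv_const (c : ℝ) : dirDeriv X (fun _ ↦ c) x = 0 := by
  simp [dirDeriv, mvfderiv_const]

lemma dirDeriv_congr {X' : Π x : M, TangentSpace (𝓡 n) x} (hX : X =ᶠ[𝓝 x] X')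
    (hf : f =ᶠ[𝓝 x] g) : dirDeriv X f x = dirDeriv X' g x := by
  simp only [dirDeriv, mvfderiv, hX.self_of_nhds, hf.mfderiv_eq]
  have := hf.self_of_nhds
  congr!

variable [IsManifold (𝓡 n) ∞ M]

lemma mlieBracket_smul_right' (hf : MDifferentiableAt (𝓡 n) 𝓘(ℝ, ℝ) f x) (hY : MDifferentiableAt (𝓡 n) (𝓡 n).tangent
      (fun y ↦ (⟨y, Y y⟩ : TangentBundle (𝓡 n) M)) x) :
    mlieBracket (𝓡 n) X (f • Y) x = dirDeriv X f x • Y x + f x • mlieBracket (𝓡 n) X Y x :=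
  mlieBracket_smul_right hf hY

/-- The Lie bracket of vector fields is the commutator of the associated derivations. -/
lemma dirDeriv_mlieBracket [T2Space M] (hX : SmoothVF X) (hY : SmoothVF Y)
    (hf : ContMDiff (𝓡 n) 𝓘(ℝ, ℝ) ∞ f) (x : M) :
    dirDeriv (mlieBracket (𝓡 n) X Y) f x
      = dirDeriv X (dirDeriv Y f) x - dirDeriv Y (dirDeriv X f) x := by
  -- The identity will appear as the coefficient of Z x in the Jacobi identity for X, Y, f • Z, so a
  -- field with Z x ≠ 0 is needed.
  by_cases h0 : ∀ v : TangentSpace (𝓡 n) x, v = 0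
  · simp [dirDeriv, h0 (mlieBracket (𝓡 n) X Y x), h0 (X x), h0 (Y x)]
  push Not at h0
  obtain ⟨v, hv⟩ := h0
  obtain ⟨Z, hZ, rfl⟩ := exists_smoothVF_eq v
  have bra {V W : Π x : M, TangentSpace (𝓡 n) x} {g : M → ℝ} (hW : SmoothVF W)
      (hg : ContMDiff (𝓡 n) 𝓘(ℝ, ℝ) ∞ g) :
      mlieBracket (𝓡 n) V (g • W) = dirDeriv V g • W + g • mlieBracket (𝓡 n) V W :=
    funext fun y ↦ mlieBracket_smul_right' ((hg y).mdifferentiableAt (by simp))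
      (hW.mdifferentiableAt y)
  have : IsManifold (𝓡 n) (minSmoothness ℝ 3) M := by
    simpa using (inferInstance : IsManifold (𝓡 n) 3 M)
  have h2 : minSmoothness ℝ 2 ≤ ∞ := by
    rw [minSmoothness_of_isRCLikeNormedField]; exact ENat.LEInfty.out
  have jac {U V W : Π x : M, TangentSpace (𝓡 n) x} (hU : SmoothVF U) (hV : SmoothVF V)
      (hW : SmoothVF W) := leibniz_identity_mlieBracket_apply (I := 𝓡 n) (x := x)
        ((hU x).of_le h2) ((hV x).of_le h2) ((hW x).of_le h2)
  have key := jac hX hY (hZ.smul hf)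
  have key0 := jac hX hY hZ
  have hXf := hX.dirDeriv hf
  have hYf := hY.dirDeriv hf
  have add {V W W' : Π x : M, TangentSpace (𝓡 n) x} (hW : SmoothVF W) (hW' : SmoothVF W') :
      mlieBracket (𝓡 n) V (W + W') x = mlieBracket (𝓡 n) V W x + mlieBracket (𝓡 n) V W' x :=
    mlieBracket_add_right (hW.mdifferentiableAt x) (hW'.mdifferentiableAt x)
  rw [bra hZ hf, bra hZ hf, bra hZ hf, add (hZ.smul hYf) ((hY.mlieBracket hZ).smul hf),
    add (hZ.smul hXf) ((hX.mlieBracket hZ).smul hf), bra hZ hYf, bra hZ hXf,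
    bra (hY.mlieBracket hZ) hf, bra (hX.mlieBracket hZ) hf] at key
  simp only [Pi.add_apply, Pi.smul_apply', key0] at key
  have : (dirDeriv (mlieBracket (𝓡 n) X Y) f x
      - (dirDeriv X (dirDeriv Y f) x - dirDeriv Y (dirDeriv X f) x)) • Z x = 0 := by
    rw [← sub_eq_zero.2 key.symm]
    module
  rcases smul_eq_zero.1 this with h | h
  · linarith
  · exact absurd h hv

end DirDeriv

/-! ### The Levi-Civita connection -/

section LeviCivita

variable {n : ℕ} {M : Type*} [TopologicalSpace M]
  [ChartedSpace (EuclideanSpace ℝ (Fin n)) M] [IsManifold (𝓡 n) ∞ M]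
  [RiemannianBundle (fun x : M ↦ TangentSpace (𝓡 n) x)]

section Locality

variable {X X' Y Y' Z Z' : Π x : M, TangentSpace (𝓡 n) x} {x : M}

lemma koszul_congr (hX : X =ᶠ[𝓝 x] X') (hY : Y =ᶠ[𝓝 x] Y') (hZ : Z =ᶠ[𝓝 x] Z') :
    koszul X Y Z x = koszul X' Y' Z' x := by
  have inn {U U' V V' : Π x : M, TangentSpace (𝓡 n) x} (hU : U =ᶠ[𝓝 x] U')
      (hV : V =ᶠ[𝓝 x] V') :
      (fun y ↦ inner ℝ (U y) (V y)) =ᶠ[𝓝 x] fun y ↦ inner ℝ (U' y) (V' y) := by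
    filter_upwards [hU, hV] with y h1 h2
    rw [h1, h2]
  simp only [koszul, dirDeriv_congr hX (inn hY hZ), dirDeriv_congr hY (inn hZ hX),
    dirDeriv_congr hZ (inn hX hY), hX.mlieBracket_vectorField_eq hY,
    hY.mlieBracket_vectorField_eq hZ, hZ.mlieBracket_vectorField_eq hX, hX.self_of_nhds,
    hY.self_of_nhds, hZ.self_of_nhds]

/-- Equality of germs, not just of values at x, is what lets the lemma be iterated for the nested
connections in `riemann`. -/
lemma leviCivita_congr (hX : X =ᶠ[𝓝 x] X') (hY : Y =ᶠ[𝓝 x] Y') :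
    leviCivita X Y =ᶠ[𝓝 x] leviCivita X' Y' := by
  filter_upwards [hX.eventuallyEq_nhds, hY.eventuallyEq_nhds] with y h1 h2
  exact Finset.sum_congr rfl fun i _ ↦
    congrArg (· • onb y i) (koszul_congr h1 h2 (EventuallyEq.refl _ _))

lemma riemann_congr (hX : X =ᶠ[𝓝 x] X') (hY : Y =ᶠ[𝓝 x] Y') (hZ : Z =ᶠ[𝓝 x] Z') :
    riemann X Y Z x = riemann X' Y' Z' x := by
  simp only [riemann, (leviCivita_congr hX (leviCivita_congr hY hZ)).self_of_nhds,
    (leviCivita_congr hY (leviCivita_congr hX hZ)).self_of_nhds,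
    (leviCivita_congr (hX.mlieBracket_vectorField hY) hZ).self_of_nhds]

end Locality

lemma ContMDiff.matrix_det {ι : Type*} [Fintype ι] [DecidableEq ι] {A : M → Matrix ι ι ℝ}
    (hA : ∀ i j, ContMDiff (𝓡 n) 𝓘(ℝ, ℝ) ∞ fun y ↦ A y i j) :
    ContMDiff (𝓡 n) 𝓘(ℝ, ℝ) ∞ fun y ↦ (A y).det := by
  simp only [Matrix.det_apply']
  exact contMDiff_finsetSum fun σ _ ↦ contMDiff_const.mul
    (contMDiff_finsetProd fun i _ ↦ hA _ _)

lemma linearIndependent_of_det_inner_ne_zero {ι V : Type*} [Fintype ι] [DecidableEq ι]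
    [NormedAddCommGroup V] [InnerProductSpace ℝ V] {e : ι → V}
    (h : (Matrix.of fun i j ↦ inner ℝ (e i) (e j)).det ≠ 0) : LinearIndependent ℝ e := by
  rw [Fintype.linearIndependent_iff]
  intro c hc
  refine congrFun (Matrix.eq_zero_of_mulVec_eq_zero h (funext fun i ↦ ?_))
  have := congrArg (inner ℝ (e i)) hc
  simpa [Matrix.mulVec, dotProduct, inner_sum, real_inner_smul_right, mul_comm] using this

variable [IsContMDiffRiemannianBundle (𝓡 n) ∞ (EuclideanSpace ℝ (Fin n))
    (fun x : M ↦ TangentSpace (𝓡 n) x)]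
  {X X' Y Y' Z Z' : Π x : M, TangentSpace (𝓡 n) x} {x : M}

lemma SmoothVF.inner (hX : SmoothVF X) (hY : SmoothVF Y) :
    ContMDiff (𝓡 n) 𝓘(ℝ, ℝ) ∞ (fun y ↦ inner ℝ (X y) (Y y)) :=
  ContMDiff.inner_bundle (F := EuclideanSpace ℝ (Fin n))
    (E := fun y : M ↦ TangentSpace (𝓡 n) y) hX hY

lemma mdifferentiableAt_inner
    (hX : MDifferentiableAt (𝓡 n) (𝓡 n).tangent (fun y ↦ (⟨y, X y⟩ : TangentBundle (𝓡 n) M)) x)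
    (hY : MDifferentiableAt (𝓡 n) (𝓡 n).tangent (fun y ↦ (⟨y, Y y⟩ : TangentBundle (𝓡 n) M)) x) :
    MDifferentiableAt (𝓡 n) 𝓘(ℝ, ℝ) (fun y ↦ inner ℝ (X y) (Y y)) x :=
  have : IsContMDiffRiemannianBundle (𝓡 n) 1 (EuclideanSpace ℝ (Fin n))
      (fun x : M ↦ TangentSpace (𝓡 n) x) :=
    .of_le (n := ∞) ENat.LEInfty.out
  MDifferentiableAt.inner_bundle (F := EuclideanSpace ℝ (Fin n))
    (E := fun y : M ↦ TangentSpace (𝓡 n) y) hX hY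

/-- A vector field whose inner products with all smooth vector fields are smooth is smooth. -/
lemma smoothVF_of_inner [T2Space M]
    (h : ∀ Z : Π x : M, TangentSpace (𝓡 n) x, SmoothVF Z →
      ContMDiff (𝓡 n) 𝓘(ℝ, ℝ) ∞ (fun y ↦ inner ℝ (X y) (Z y))) : SmoothVF X := by
  intro x
  -- The fields E are orthonormal at x only, but their Gram matrix G stays invertible nearby. The
  -- coefficients of X in this frame solve a linear system with matrix G, and Cramer's rule writes
  -- them as quotients of smooth determinants.
  choose E hE hEx using fun i ↦ exists_smoothVF_eq (onb (n := n) x i)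
  let G (y : M) : Matrix _ _ ℝ := Matrix.of fun i j ↦ inner ℝ (E i y) (E j y)
  let b (y : M) : _ → ℝ := fun i ↦ inner ℝ (X y) (E i y)
  have hG : ContMDiff (𝓡 n) 𝓘(ℝ, ℝ) ∞ fun y ↦ (G y).det :=
    ContMDiff.matrix_det fun i j ↦ (hE i).inner (hE j)
  have hc (i) : ContMDiff (𝓡 n) 𝓘(ℝ, ℝ) ∞ fun y ↦ (G y).cramer (b y) i := by
    simp only [Matrix.cramer_apply]
    refine ContMDiff.matrix_det fun k j ↦ ?_
    by_cases hj : j = i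
    · subst hj
      simpa [b] using h _ (hE k)
    · simpa [hj, G, Matrix.updateCol_apply] using (hE k).inner (hE j)
  have hGx : (G x).det ≠ 0 := by
    have : G x = 1 := by
      ext i j
      simp [G, hEx, Matrix.one_apply, orthonormal_iff_ite.1 (onb x).orthonormal i j]
    simp [this]
  have hsm : ContMDiffAt (𝓡 n) (𝓡 n).tangent ∞ (fun y ↦ (⟨y, ∑ i,
      ((fun z ↦ ((G z).det)⁻¹ * (G z).cramer (b z) i) • E i) y⟩ : TangentBundle (𝓡 n) M)) x :=
    ContMDiffAt.sum_section (F := EuclideanSpace ℝ (Fin n))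
      (V := fun y : M ↦ TangentSpace (𝓡 n) y) fun i _ ↦
      (((hG x).inv₀ hGx).mul (hc i x)).smul_section (hE i x)
  refine hsm.congr_of_eventuallyEq ?_
  filter_upwards [hG.continuous.continuousAt.eventually_ne hGx] with y hy
  have hli := linearIndependent_of_det_inner_ne_zero hy
  have hspan := hli.span_eq_top_of_card_eq_finrank' (by simp; rfl)
  -- The error of the Cramer expansion is orthogonal to a spanning family, hence to itself.
  have hort : ∀ w, inner ℝ (X y - ∑ i, (((G y).det)⁻¹ * (G y).cramer (b y) i) • E i y) w = 0 := by
    intro w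
    have hw : w ∈ Submodule.span ℝ (Set.range fun i ↦ E i y) := by rw [hspan]; trivial
    induction hw using Submodule.span_induction with
    | mem w hw =>
      obtain ⟨j, rfl⟩ := hw
      have := congrFun (Matrix.mulVec_cramer (G y) (b y)) j
      simp only [Matrix.mulVec, dotProduct, Pi.smul_apply, smul_eq_mul] at this
      simp only [inner_sub_left, sum_inner, real_inner_smul_left, mul_assoc, ← Finset.mul_sum]
      have h2 : ∑ i, (G y).cramer (b y) i * inner ℝ (E i y) (E j y) = (G y).det * b y j := by
        rw [← this]
        refine Finset.sum_congr rfl fun i _ ↦ ?_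
        rw [mul_comm, real_inner_comm]
        rfl
      rw [h2]
      field_simp
      simp [b]
    | zero => simp
    | add u v _ _ hu hv => rw [inner_add_right, hu, hv, add_zero]
    | smul c u _ hu => rw [real_inner_smul_right, hu, mul_zero]
  have := sub_eq_zero.1 (inner_self_eq_zero.1 (hort _))
  simp only [Pi.smul_apply', ← this]

/-- For f • Z, the terms (X f) g(Y,Z) and (Y f) g(Z,X) are cancelled by those from the brackets
[fZ,X] and [Y,fZ]. This makes the choice of extensions in `leviCivita` immaterial. -/
lemma koszul_tensorialAt (hX : SmoothVF X) (hY : SmoothVF Y) (x : M) :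
    TensorialAt (𝓡 n) (EuclideanSpace ℝ (Fin n)) (V := fun y : M ↦ TangentSpace (𝓡 n) y)
      (fun Z ↦ koszul X Y Z x) x where
  smul {f Z} hf hZ := by
    have h1 : dirDeriv X (fun y ↦ inner ℝ (Y y) ((f • Z) y)) x
        = f x * dirDeriv X (fun y ↦ inner ℝ (Y y) (Z y)) x
          + inner ℝ (Y x) (Z x) * dirDeriv X f x := by
      simp only [Pi.smul_apply', real_inner_smul_right]
      exact dirDeriv_mul hf (mdifferentiableAt_inner (hY.mdifferentiableAt x) hZ)
    have h2 : dirDeriv Y (fun y ↦ inner ℝ ((f • Z) y) (X y)) x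
        = f x * dirDeriv Y (fun y ↦ inner ℝ (Z y) (X y)) x
          + inner ℝ (Z x) (X x) * dirDeriv Y f x := by
      simp only [Pi.smul_apply', real_inner_smul_left]
      exact dirDeriv_mul hf (mdifferentiableAt_inner hZ (hX.mdifferentiableAt x))
    have h3 : dirDeriv (f • Z) (fun y ↦ inner ℝ (X y) (Y y)) x
        = f x * dirDeriv Z (fun y ↦ inner ℝ (X y) (Y y)) x := by
      simp [dirDeriv]
    simp only [koszul, h1, h2, h3, mlieBracket_smul_right' hf hZ]
    rw [mlieBracket_swap_apply (V := f • Z), mlieBracket_swap_apply (V := Z),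
      mlieBracket_smul_right' hf hZ]
    simp only [Pi.smul_apply', inner_add_left, inner_neg_left, real_inner_smul_left,
      real_inner_smul_right, smul_eq_mul, real_inner_comm (Z x) (Y x)]
    ring
  add {Z Z'} hZ hZ' := by
    have h1 : dirDeriv X (fun y ↦ inner ℝ (Y y) ((Z + Z') y)) x
        = dirDeriv X (fun y ↦ inner ℝ (Y y) (Z y)) x
          + dirDeriv X (fun y ↦ inner ℝ (Y y) (Z' y)) x := by
      simp only [Pi.add_apply, inner_add_right]
      exact dirDeriv_add (mdifferentiableAt_inner (hY.mdifferentiableAt x) hZ)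
        (mdifferentiableAt_inner (hY.mdifferentiableAt x) hZ')
    have h2 : dirDeriv Y (fun y ↦ inner ℝ ((Z + Z') y) (X y)) x
        = dirDeriv Y (fun y ↦ inner ℝ (Z y) (X y)) x
          + dirDeriv Y (fun y ↦ inner ℝ (Z' y) (X y)) x := by
      simp only [Pi.add_apply, inner_add_left]
      exact dirDeriv_add (mdifferentiableAt_inner hZ (hX.mdifferentiableAt x))
        (mdifferentiableAt_inner hZ' (hX.mdifferentiableAt x))
    have h3 : dirDeriv (Z + Z') (fun y ↦ inner ℝ (X y) (Y y)) x
        = dirDeriv Z (fun y ↦ inner ℝ (X y) (Y y)) x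
          + dirDeriv Z' (fun y ↦ inner ℝ (X y) (Y y)) x := by
      simp [dirDeriv]
    simp only [koszul, h1, h2, h3, mlieBracket_add_right hZ hZ', mlieBracket_add_left hZ hZ']
    simp only [Pi.add_apply, inner_add_left, inner_add_right]
    ring

lemma inner_leviCivita (hX : SmoothVF X) (hY : SmoothVF Y) (hZ : SmoothVF Z) (x : M) :
    inner ℝ (leviCivita X Y x) (Z x) = koszul X Y Z x := by
  have ht := koszul_tensorialAt hX hY x
  rw [← TensorialAt.mkHom_apply ht (hZ.mdifferentiableAt x), leviCivita, sum_inner]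
  conv_rhs => rw [← (onb x).sum_repr (Z x), map_sum]
  refine Finset.sum_congr rfl fun i _ ↦ ?_
  rw [real_inner_smul_left, map_smul, TensorialAt.mkHom_apply_eq_extend, smul_eq_mul, mul_comm,
    OrthonormalBasis.repr_apply_apply]
  rfl

variable [T2Space M]

lemma eq_of_forall_inner_smoothVF {v w : TangentSpace (𝓡 n) x}
    (h : ∀ Z : Π x : M, TangentSpace (𝓡 n) x, SmoothVF Z → inner ℝ v (Z x) = inner ℝ w (Z x)) :
    v = w := by
  refine ext_inner_right ℝ fun z ↦ ?_
  obtain ⟨Z, hZ, rfl⟩ := exists_smoothVF_eq z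
  exact h Z hZ

lemma SmoothVF.leviCivita (hX : SmoothVF X) (hY : SmoothVF Y) : SmoothVF (leviCivita X Y) := by
  refine smoothVF_of_inner fun Z hZ ↦ ?_
  simp only [inner_leviCivita hX hY hZ, koszul]
  exact contMDiff_const.mul ((((((hX.dirDeriv (hY.inner hZ)).add (hY.dirDeriv (hZ.inner hX))).sub
    (hZ.dirDeriv (hX.inner hY))).add ((hX.mlieBracket hY).inner hZ)).sub
    ((hY.mlieBracket hZ).inner hX)).add ((hZ.mlieBracket hX).inner hY))

lemma leviCivita_torsion_free (hX : SmoothVF X) (hY : SmoothVF Y) (x : M) :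
    leviCivita X Y x - leviCivita Y X x = mlieBracket (𝓡 n) X Y x := by
  refine eq_of_forall_inner_smoothVF fun Z hZ ↦ ?_
  have c (U V : Π x : M, TangentSpace (𝓡 n) x) :
      (fun y ↦ inner ℝ (U y) (V y)) = fun y ↦ inner ℝ (V y) (U y) :=
    funext fun y ↦ real_inner_comm _ _
  rw [inner_sub_left, inner_leviCivita hX hY hZ, inner_leviCivita hY hX hZ, koszul, koszul,
    mlieBracket_swap_apply (V := Y) (W := X), mlieBracket_swap_apply (V := X) (W := Z),
    mlieBracket_swap_apply (V := Z) (W := Y), c X Z, c Z Y, c X Y]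
  simp only [inner_neg_left]
  ring

lemma dirDeriv_inner (hX : SmoothVF X) (hY : SmoothVF Y) (hZ : SmoothVF Z) (x : M) :
    dirDeriv X (fun y ↦ inner ℝ (Y y) (Z y)) x
      = inner ℝ (leviCivita X Y x) (Z x) + inner ℝ (Y x) (leviCivita X Z x) := by
  have c (U V : Π x : M, TangentSpace (𝓡 n) x) :
      (fun y ↦ inner ℝ (U y) (V y)) = fun y ↦ inner ℝ (V y) (U y) :=
    funext fun y ↦ real_inner_comm _ _
  rw [real_inner_comm (leviCivita X Z x), inner_leviCivita hX hY hZ, inner_leviCivita hX hZ hY, koszul, koszul,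
    mlieBracket_swap_apply (V := Y) (W := X), mlieBracket_swap_apply (V := X) (W := Z),
    mlieBracket_swap_apply (V := Z) (W := Y), c X Z, c Z Y, c X Y]
  simp only [inner_neg_left]
  ring

lemma leviCivita_sub (hX : SmoothVF X) (hY : SmoothVF Y) (hZ : SmoothVF Z) (x : M) :
    leviCivita X (Y - Z) x = leviCivita X Y x - leviCivita X Z x := by
  refine eq_of_forall_inner_smoothVF fun W hW ↦ ?_
  have h1 := dirDeriv_inner hX (hY.sub hZ) hW x
  have h2 := dirDeriv_inner hX hY hW x
  have h3 := dirDeriv_inner hX hZ hW x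
  simp only [Pi.sub_apply, inner_sub_left] at h1 ⊢
  rw [dirDeriv_sub (((hY.inner hW) x).mdifferentiableAt (by simp))
    (((hZ.inner hW) x).mdifferentiableAt (by simp))] at h1
  linarith

end LeviCivita

/-! ### Curvature-like forms on a 3-dimensional space -/

section Algebraic

variable {V : Type*} [NormedAddCommGroup V] [InnerProductSpace ℝ V]

/-- A `4`-linear form with the antisymmetries and the pair symmetry of a curvature tensor. -/
structure IsCurvatureLike (R : V → V → V → V → ℝ) : Prop where
  swap : ∀ a b c d, R a b c d = -R b a c d
  pair : ∀ a b c d, R a b c d = R c d a b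
  add_right : ∀ a b c d d', R a b c (d + d') = R a b c d + R a b c d'
  smul_right : ∀ a b c (r : ℝ) d, R a b c (r • d) = r * R a b c d

namespace IsCurvatureLike

variable {R R' : V → V → V → V → ℝ}

lemma skew (hR : IsCurvatureLike R) (a b c d : V) : R a b c d = -R a b d c := by
  rw [hR.pair a b c d, hR.swap, hR.pair d c]

lemma sub (hR : IsCurvatureLike R) (hR' : IsCurvatureLike R') :
    IsCurvatureLike fun a b c d ↦ R a b c d - R' a b c d where
  swap a b c d := by rw [hR.swap, hR'.swap]; ring
  pair a b c d := by rw [hR.pair, hR'.pair]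
  add_right a b c d d' := by rw [hR.add_right, hR'.add_right]; ring
  smul_right a b c r d := by rw [hR.smul_right, hR'.smul_right]; ring

lemma add (hR : IsCurvatureLike R) (hR' : IsCurvatureLike R') :
    IsCurvatureLike fun a b c d ↦ R a b c d + R' a b c d where
  swap a b c d := by rw [hR.swap, hR'.swap]; ring
  pair a b c d := by rw [hR.pair, hR'.pair]
  add_right a b c d d' := by rw [hR.add_right, hR'.add_right]; ring
  smul_right a b c r d := by rw [hR.smul_right, hR'.smul_right]; ring

lemma const_mul (k : ℝ) (hR : IsCurvatureLike R) :
    IsCurvatureLike fun a b c d ↦ k * R a b c d where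
  swap a b c d := by rw [hR.swap]; ring
  pair a b c d := by rw [hR.pair]
  add_right a b c d d' := by rw [hR.add_right]; ring
  smul_right a b c r d := by rw [hR.smul_right]; ring

/-- A curvature-like form as a bilinear form in its last two arguments. -/
noncomputable def bilin (hR : IsCurvatureLike R) (a b : V) : V →ₗ[ℝ] V →ₗ[ℝ] ℝ :=
  LinearMap.mk₂ ℝ (R a b)
    (fun c c' d ↦ by rw [hR.skew, hR.add_right, hR.skew a b c, hR.skew a b c']; ring)
    (fun r c d ↦ by rw [hR.skew, hR.smul_right, hR.skew a b c, smul_eq_mul]; ring)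
    (hR.add_right a b) (fun r c d ↦ hR.smul_right a b c r d)

end IsCurvatureLike

/-- A symmetric endomorphism `A` gives the curvature-like form `g ∧ A` (Kulkarni–Nomizu). -/
def kulkarniNomizu (A : V → V) (a b c d : V) : ℝ :=
  inner ℝ b c * inner ℝ (A a) d - inner ℝ a c * inner ℝ (A b) d
    + inner ℝ (A b) c * inner ℝ a d - inner ℝ (A a) c * inner ℝ b d

lemma isCurvatureLike_kulkarniNomizu {A : V → V}
    (hA : ∀ v w, inner ℝ (A v) w = inner ℝ v (A w)) :
    IsCurvatureLike (kulkarniNomizu A) where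
  swap a b c d := by simp only [kulkarniNomizu]; ring
  pair a b c d := by
    have s (v w) : inner ℝ (A v) w = inner ℝ (A w) v := by rw [hA, real_inner_comm]
    simp only [kulkarniNomizu]
    rw [s c b, s d b, s d a, s c a, real_inner_comm d a, real_inner_comm c b,
      real_inner_comm c a, real_inner_comm d b]
    ring
  add_right a b c d d' := by simp only [kulkarniNomizu, inner_add_right]; ring
  smul_right a b c r d := by simp only [kulkarniNomizu, real_inner_smul_right]; ring

lemma isCurvatureLike_inner :
    IsCurvatureLike fun a b c d : V ↦ inner ℝ b c * inner ℝ a d - inner ℝ a c * inner ℝ b d where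
  swap a b c d := by ring
  pair a b c d := by
    rw [real_inner_comm d a, real_inner_comm c b, real_inner_comm c a, real_inner_comm d b]; ring
  add_right a b c d d' := by simp only [inner_add_right]; ring
  smul_right a b c r d := by simp only [real_inner_smul_right]; ring

lemma isCurvatureLike_reeb (ξ : V) :
    IsCurvatureLike fun a b c d : V ↦ inner ℝ ξ a * inner ℝ ξ c * inner ℝ b d
      - inner ℝ ξ b * inner ℝ ξ c * inner ℝ a d + inner ℝ a c * inner ℝ ξ b * inner ℝ ξ d
      - inner ℝ b c * inner ℝ ξ a * inner ℝ ξ d where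
  swap a b c d := by ring
  pair a b c d := by
    rw [real_inner_comm d a, real_inner_comm c b, real_inner_comm c a, real_inner_comm d b]; ring
  add_right a b c d d' := by simp only [inner_add_right]; ring
  smul_right a b c r d := by simp only [real_inner_smul_right]; ring

/-- Modulo the kernel vector f 0 the space is a plane, where alternating forms are multiples of the
area form. -/
lemma alternating_eq_of_kernel (f : OrthonormalBasis (Fin 3) ℝ V) (B : V →ₗ[ℝ] V →ₗ[ℝ] ℝ)
    (hB : ∀ v w, B v w = -B w v) (h0 : ∀ v, B (f 0) v = 0) (v w : V) :
    B v w = (inner ℝ (f 1) v * inner ℝ (f 2) w - inner ℝ (f 2) v * inner ℝ (f 1) w)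
      * B (f 1) (f 2) := by
  have h0' (v) : B v (f 0) = 0 := by rw [hB, h0, neg_zero]
  have hs (v) : B v v = 0 := by linarith [hB v v]
  conv_lhs => rw [← f.sum_repr' v, ← f.sum_repr' w]
  simp only [Fin.sum_univ_three, map_add, map_smul, LinearMap.add_apply, LinearMap.smul_apply,
    smul_eq_mul, h0, h0', hs, hB (f 2) (f 1)]
  ring

lemma exists_orthonormalBasis_apply_zero (hV : Module.finrank ℝ V = 3) {ξ : V} (hξ : ‖ξ‖ = 1) :
    ∃ f : OrthonormalBasis (Fin 3) ℝ V, f 0 = ξ := by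
  have : FiniteDimensional ℝ V := .of_finrank_eq_succ hV
  have hv : Orthonormal ℝ (({0} : Set (Fin 3)).domRestrict fun _ ↦ ξ) :=
    ⟨fun _ ↦ hξ, fun i j hij ↦ absurd (Subsingleton.elim i j) hij⟩
  obtain ⟨b, hb⟩ := hv.exists_orthonormalBasis_extension_of_card_eq (by simpa using hV)
  exact ⟨b, hb 0 rfl⟩

/-- On a `3`-dimensional space a curvature-like form that annihilates a unit vector and has zero
scalar curvature vanishes. -/
lemma IsCurvatureLike.eq_zero {R : V → V → V → V → ℝ} (hR : IsCurvatureLike R)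
    (hV : Module.finrank ℝ V = 3) {ξ : V} (hξ : ‖ξ‖ = 1) (h0 : ∀ a b d, R a b ξ d = 0)
    {ι : Type*} [Fintype ι] (e : OrthonormalBasis ι ℝ V)
    (htr : ∑ i, ∑ j, R (e i) (e j) (e j) (e i) = 0) (a b c d : V) : R a b c d = 0 := by
  obtain ⟨f, rfl⟩ := exists_orthonormalBasis_apply_zero hV hξ
  have h1 (a b c d) := alternating_eq_of_kernel f (hR.bilin a b) (hR.skew a b) (h0 a b) c d
  have h2 (a b c d) : R a b c d
      = (inner ℝ (f 1) c * inner ℝ (f 2) d - inner ℝ (f 2) c * inner ℝ (f 1) d)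
        * R a b (f 1) (f 2) := h1 a b c d
  -- Pair symmetry carries the reduction from the last two arguments to the first two, leaving a
  -- single unknown number.
  have h3 (a b c d) : R a b c d
      = (inner ℝ (f 1) c * inner ℝ (f 2) d - inner ℝ (f 2) c * inner ℝ (f 1) d)
        * ((inner ℝ (f 1) a * inner ℝ (f 2) b - inner ℝ (f 2) a * inner ℝ (f 1) b)
        * R (f 1) (f 2) (f 1) (f 2)) := by
    rw [h2, hR.pair a b, h2 (f 1) (f 2) a b]
  have p (v w : V) : ∑ i, inner ℝ v (e i) * inner ℝ w (e i) = inner ℝ v w := by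
    rw [← e.sum_inner_mul_inner v w]
    exact Finset.sum_congr rfl fun i _ ↦ by rw [real_inner_comm (e i) w]
  have o11 : inner ℝ (f 1) (f 1) = 1 := orthonormal_iff_ite.1 f.orthonormal 1 1
  have o22 : inner ℝ (f 2) (f 2) = 1 := orthonormal_iff_ite.1 f.orthonormal 2 2
  have o12 : inner ℝ (f 1) (f 2) = 0 := f.orthonormal.2 (by decide)
  have key : ∑ i, ∑ j, R (e i) (e j) (e j) (e i) = -2 * R (f 1) (f 2) (f 1) (f 2) := by
    have e1 (i j) : R (e i) (e j) (e j) (e i) =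
        ((inner ℝ (f 1) (e i) * inner ℝ (f 2) (e i))
            * (inner ℝ (f 1) (e j) * inner ℝ (f 2) (e j))
          + (inner ℝ (f 1) (e i) * inner ℝ (f 2) (e i))
            * (inner ℝ (f 1) (e j) * inner ℝ (f 2) (e j))
          - (inner ℝ (f 1) (e i) * inner ℝ (f 1) (e i))
            * (inner ℝ (f 2) (e j) * inner ℝ (f 2) (e j))
          - (inner ℝ (f 2) (e i) * inner ℝ (f 2) (e i))
            * (inner ℝ (f 1) (e j) * inner ℝ (f 1) (e j))) * R (f 1) (f 2) (f 1) (f 2) := by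
      rw [h3 (e i)]; ring
    simp only [e1, ← Finset.sum_mul, Finset.sum_add_distrib, Finset.sum_sub_distrib,
      ← Finset.mul_sum, p, o11, o22, o12]
    norm_num
  rw [h3, show R (f 1) (f 2) (f 1) (f 2) = 0 by linarith]
  ring

/-- A curvature-like form on a `3`-dimensional space is determined by its values at a unit vector
`ξ` and by its scalar curvature. -/
lemma IsCurvatureLike.eq_of_reeb {R : V → V → V → V → ℝ} (hR : IsCurvatureLike R)
    (hV : Module.finrank ℝ V = 3) {ξ : V} (hξ : ‖ξ‖ = 1) {A B : V → V}
    (hA : ∀ v w, inner ℝ (A v) w = inner ℝ v (A w))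
    (hB : ∀ v w, inner ℝ (B v) w = inner ℝ v (B w)) (hAξ : A ξ = 0) (hBξ : B ξ = 0)
    {ι : Type*} [Fintype ι] (e : OrthonormalBasis ι ℝ V)
    (hAtr : ∑ i, inner ℝ (A (e i)) (e i) = 0) (hBtr : ∑ i, inner ℝ (B (e i)) (e i) = 0)
    {κ μ ν τ : ℝ} (hτ : ∑ i, ∑ j, R (e i) (e j) (e j) (e i) = τ)
    (hRξ : ∀ a b d, R a b ξ d
      = κ * (inner ℝ ξ b * inner ℝ a d - inner ℝ ξ a * inner ℝ b d)
        + μ * (inner ℝ ξ b * inner ℝ (A a) d - inner ℝ ξ a * inner ℝ (A b) d)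
        + ν * (inner ℝ ξ b * inner ℝ (B a) d - inner ℝ ξ a * inner ℝ (B b) d)) (a b c d : V) :
    R a b c d = (τ / 2 - 2 * κ) * (inner ℝ b c * inner ℝ a d - inner ℝ a c * inner ℝ b d)
      + (τ / 2 - 3 * κ) * (inner ℝ ξ a * inner ℝ ξ c * inner ℝ b d
        - inner ℝ ξ b * inner ℝ ξ c * inner ℝ a d + inner ℝ a c * inner ℝ ξ b * inner ℝ ξ d
        - inner ℝ b c * inner ℝ ξ a * inner ℝ ξ d)
      + μ * kulkarniNomizu A a b c d + ν * kulkarniNomizu B a b c d := by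
  classical
  have hξξ : inner ℝ ξ ξ = 1 := by rw [real_inner_self_eq_norm_sq, hξ, one_pow]
  have hD := hR.sub ((((isCurvatureLike_inner.const_mul (τ / 2 - 2 * κ)).add
    ((isCurvatureLike_reeb ξ).const_mul (τ / 2 - 3 * κ))).add
    ((isCurvatureLike_kulkarniNomizu hA).const_mul μ)).add
    ((isCurvatureLike_kulkarniNomizu hB).const_mul ν))
  refine sub_eq_zero.1 (hD.eq_zero hV hξ (fun a b d ↦ ?_) e ?_ a b c d)
  -- At c = ξ the first two model forms are opposite, and the difference of their coefficients is κ.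
  · simp only [hRξ, kulkarniNomizu, hξξ, hA _ ξ, hB _ ξ, hAξ, hBξ, inner_zero_right,
      real_inner_comm ξ a, real_inner_comm ξ b]
    ring
  -- The scalar curvatures of the four model forms are 6, -4, 0, 0, and 6(τ/2 - 2κ) - 4(τ/2 - 3κ) =
  -- τ.
  · have on (i j) := orthonormal_iff_ite.1 e.orthonormal i j
    have p : ∑ i, inner ℝ ξ (e i) * inner ℝ ξ (e i) = 1 := by
      rw [← hξξ, ← e.sum_inner_mul_inner ξ ξ]
      exact Finset.sum_congr rfl fun i _ ↦ by rw [real_inner_comm (e i) ξ]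
    have hc : (Fintype.card ι : ℝ) = 3 := by
      rw [← Module.finrank_eq_card_basis e.toBasis, hV]; norm_num
    simp only [kulkarniNomizu, Finset.sum_sub_distrib, Finset.sum_add_distrib, ← Finset.mul_sum,
      ← Finset.sum_mul, hτ, on, hAtr, hBtr]
    simp [hAtr, hBtr, p, hc, Finset.sum_ite_eq]
    simp only [mul_left_comm _ (3 : ℝ), ← Finset.mul_sum, hAtr, hBtr, p]
    ring

end Algebraic

/-! ### Symmetries and tensoriality of the Riemann tensor -/

section Curvature

variable {n : ℕ} {M : Type*} [TopologicalSpace M]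
  [ChartedSpace (EuclideanSpace ℝ (Fin n)) M] [IsManifold (𝓡 n) ∞ M]
  [RiemannianBundle (fun x : M ↦ TangentSpace (𝓡 n) x)]
  [IsContMDiffRiemannianBundle (𝓡 n) ∞ (EuclideanSpace ℝ (Fin n))
    (fun x : M ↦ TangentSpace (𝓡 n) x)] [T2Space M]
  {X Y Z W : Π x : M, TangentSpace (𝓡 n) x} {x : M}

/-- Torsion-freeness moves the sign to the second argument, where `leviCivita_sub` applies. -/
lemma leviCivita_neg_left (hX : SmoothVF X) (hY : SmoothVF Y) (x : M) :
    leviCivita (-X) Y x = -leviCivita X Y x := by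
  have h0 : -X = (X - X) - X := by simp
  have hX' : SmoothVF (-X) := by rw [h0]; exact (hX.sub hX).sub hX
  have h1 : leviCivita Y (-X) x = -leviCivita Y X x := by
    rw [h0, leviCivita_sub hY (hX.sub hX) hX, leviCivita_sub hY hX hX]
    simp
  have h2 : mlieBracket (𝓡 n) (-X) Y x = - mlieBracket (𝓡 n) X Y x := by
    have := mlieBracket_const_smul_left (I := 𝓡 n) (c := (-1 : ℝ)) (W := Y)
      (hX.mdifferentiableAt x)
    simpa using this
  have h3 := leviCivita_torsion_free hX' hY x
  have h4 := leviCivita_torsion_free hX hY x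
  rw [h1, h2, ← h4] at h3
  rw [sub_eq_iff_eq_add] at h3
  rw [h3]
  abel

lemma riemann_swap (hX : SmoothVF X) (hY : SmoothVF Y) (hZ : SmoothVF Z) (x : M) :
    riemann X Y Z x = -riemann Y X Z x := by
  rw [riemann, riemann, mlieBracket_swap (V := X) (W := Y),
    leviCivita_neg_left (hY.mlieBracket hX) hZ]
  abel

/-- Differentiate g(Z,W) twice by metric compatibility: in the commutator the mixed terms cancel,
and [X,Y] g(Z,W) accounts for the rest. -/
lemma inner_riemann_skew (hX : SmoothVF X) (hY : SmoothVF Y) (hZ : SmoothVF Z) (hW : SmoothVF W)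
    (x : M) : inner ℝ (riemann X Y Z x) (W x) = -inner ℝ (riemann X Y W x) (Z x) := by
  have key := dirDeriv_mlieBracket hX hY (hZ.inner hW) x
  have d2 {U V : Π x : M, TangentSpace (𝓡 n) x} (hU : SmoothVF U) (hV : SmoothVF V) :
      dirDeriv U (dirDeriv V fun y ↦ inner ℝ (Z y) (W y)) x
        = inner ℝ (leviCivita U (leviCivita V Z) x) (W x)
          + inner ℝ (leviCivita V Z x) (leviCivita U W x)
          + (inner ℝ (leviCivita U Z x) (leviCivita V W x)
          + inner ℝ (Z x) (leviCivita U (leviCivita V W) x)) := by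
    have : dirDeriv V (fun y ↦ inner ℝ (Z y) (W y)) =
        fun y ↦ inner ℝ (leviCivita V Z y) (W y) + inner ℝ (Z y) (leviCivita V W y) :=
      funext (dirDeriv_inner hV hZ hW)
    rw [this, dirDeriv_add ((((hV.leviCivita hZ).inner hW) x).mdifferentiableAt (by simp))
      (((hZ.inner (hV.leviCivita hW)) x).mdifferentiableAt (by simp)),
      dirDeriv_inner hU (hV.leviCivita hZ) hW, dirDeriv_inner hU hZ (hV.leviCivita hW)]
  rw [d2 hX hY, d2 hY hX, dirDeriv_inner (hX.mlieBracket hY) hZ hW] at key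
  rw [real_inner_comm (Z x)]
  simp only [riemann, inner_sub_left, inner_sub_right]
  linarith

/-- Torsion-freeness turns the cyclic sum into double brackets, which cancel by the Jacobi identity.
-/
lemma riemann_bianchi (hX : SmoothVF X) (hY : SmoothVF Y) (hZ : SmoothVF Z) (x : M) :
    riemann X Y Z x + riemann Y Z X x + riemann Z X Y x = 0 := by
  have : IsManifold (𝓡 n) (minSmoothness ℝ 3) M := by
    simpa using (inferInstance : IsManifold (𝓡 n) 3 M)
  have h2 : minSmoothness ℝ 2 ≤ ∞ := by
    rw [minSmoothness_of_isRCLikeNormedField]; exact ENat.LEInfty.out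
  have jac := leibniz_identity_mlieBracket_apply (I := 𝓡 n) (x := x)
    ((hX x).of_le h2) ((hY x).of_le h2) ((hZ x).of_le h2)
  have key {U V W : Π x : M, TangentSpace (𝓡 n) x} (hU : SmoothVF U) (hV : SmoothVF V)
      (hW : SmoothVF W) : leviCivita U (leviCivita V W) x - leviCivita U (leviCivita W V) x
        - leviCivita (mlieBracket (𝓡 n) V W) U x
        = mlieBracket (𝓡 n) U (mlieBracket (𝓡 n) V W) x := by
    rw [← leviCivita_sub hU (hV.leviCivita hW) (hW.leviCivita hV),
      show leviCivita V W - leviCivita W V = mlieBracket (𝓡 n) V W from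
        funext (leviCivita_torsion_free hV hW), leviCivita_torsion_free hU (hV.mlieBracket hW)]
  have k1 := key hX hY hZ
  have k2 := key hY hZ hX
  have k3 := key hZ hX hY
  have : riemann X Y Z x + riemann Y Z X x + riemann Z X Y x
      = mlieBracket (𝓡 n) X (mlieBracket (𝓡 n) Y Z) x
        + mlieBracket (𝓡 n) Y (mlieBracket (𝓡 n) Z X) x
        + mlieBracket (𝓡 n) Z (mlieBracket (𝓡 n) X Y) x := by
    rw [← k1, ← k2, ← k3]
    simp only [riemann]
    abel
  have hneg : mlieBracket (𝓡 n) Y (mlieBracket (𝓡 n) Z X) x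
      = -mlieBracket (𝓡 n) Y (mlieBracket (𝓡 n) X Z) x := by
    rw [mlieBracket_swap (V := Z) (W := X), ← neg_one_smul ℝ (mlieBracket (𝓡 n) X Z),
      mlieBracket_const_smul_right ((hX.mlieBracket hZ).mdifferentiableAt x)]
    simp
  rw [this, jac, hneg, mlieBracket_swap_apply (V := Z)]
  abel

/-- The classical combination of four Bianchi identities with the two antisymmetries. -/
lemma inner_riemann_pair (hX : SmoothVF X) (hY : SmoothVF Y) (hZ : SmoothVF Z) (hW : SmoothVF W)
    (x : M) : inner ℝ (riemann X Y Z x) (W x) = inner ℝ (riemann Z W X x) (Y x) := by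
  have bi {A B C D : Π x : M, TangentSpace (𝓡 n) x} (hA : SmoothVF A) (hB : SmoothVF B)
      (hC : SmoothVF C) : inner ℝ (riemann A B C x) (D x) + inner ℝ (riemann B C A x) (D x)
        + inner ℝ (riemann C A B x) (D x) = 0 := by
    rw [← inner_add_left, ← inner_add_left, riemann_bianchi hA hB hC, inner_zero_left]
  have sw {A B C D : Π x : M, TangentSpace (𝓡 n) x} (hA : SmoothVF A) (hB : SmoothVF B)
      (hC : SmoothVF C) : inner ℝ (riemann A B C x) (D x) = -inner ℝ (riemann B A C x) (D x) := by
    rw [riemann_swap hA hB hC, inner_neg_left]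
  have b1 := bi (D := W) hX hY hZ
  have b2 := bi (D := X) hY hZ hW
  have b3 := bi (D := Y) hZ hW hX
  have b4 := bi (D := Z) hW hX hY
  have s1 := inner_riemann_skew hX hY hZ hW x
  have s2 := inner_riemann_skew hY hZ hX hW x
  have s3 := inner_riemann_skew hZ hX hY hW x
  have s4 := inner_riemann_skew hZ hW hX hY x
  have s5 := inner_riemann_skew hY hW hX hZ x
  have s6 := inner_riemann_skew hX hW hY hZ x
  have t1 := sw (D := X) hW hY hZ
  have t2 := sw (D := Y) hX hZ hW
  have t3 := sw (D := Y) hW hX hZ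
  have t4 := sw (D := Z) hW hX hY
  have t5 := sw (D := Z) hY hW hX
  have t6 := sw (D := Z) hX hY hW
  have t7 := sw (D := W) hX hZ hY
  have t8 := sw (D := X) hY hW hZ
  linarith

/-- The curvature tensor `g(R(a,b)c,d)` at a point. -/
noncomputable def riemannAt (x : M) (a b c d : TangentSpace (𝓡 n) x) : ℝ :=
  inner ℝ (riemann (extVF a) (extVF b) (extVF c) x) d

/-- The last slot of g(R(X,Y)Z,W) sees only a value at x; the symmetries bring each of Z, Y, X into
that slot in turn. -/
lemma riemann_eq_of_apply_eq {X' Y' Z' : Π x : M, TangentSpace (𝓡 n) x} (hX : SmoothVF X)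
    (hX' : SmoothVF X') (hY : SmoothVF Y) (hY' : SmoothVF Y') (hZ : SmoothVF Z)
    (hZ' : SmoothVF Z') (hXX : X x = X' x) (hYY : Y x = Y' x) (hZZ : Z x = Z' x) :
    riemann X Y Z x = riemann X' Y' Z' x := by
  refine eq_of_forall_inner_smoothVF fun W hW ↦ ?_
  rw [inner_riemann_skew hX hY hZ hW, hZZ, ← inner_riemann_skew hX hY hZ' hW,
    inner_riemann_pair hX hY hZ' hW, hYY, ← inner_riemann_pair hX hY' hZ' hW,
    riemann_swap hX hY' hZ', inner_neg_left, inner_riemann_pair hY' hX hZ' hW, hXX,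
    ← inner_riemann_pair hY' hX' hZ' hW, riemann_swap hX' hY' hZ', inner_neg_left]

lemma riemann_extVF (hX : SmoothVF X) (hY : SmoothVF Y) (hZ : SmoothVF Z) (x : M) :
    riemann (extVF (X x)) (extVF (Y x)) (extVF (Z x)) x = riemann X Y Z x := by
  obtain ⟨X', hX', hX''⟩ := exists_smoothVF_eventuallyEq (X x)
  obtain ⟨Y', hY', hY''⟩ := exists_smoothVF_eventuallyEq (Y x)
  obtain ⟨Z', hZ', hZ''⟩ := exists_smoothVF_eventuallyEq (Z x)
  rw [← riemann_congr hX'' hY'' hZ'']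
  apply riemann_eq_of_apply_eq hX' hX hY' hY hZ' hZ
  · rw [hX''.self_of_nhds, extVF_self]
  · rw [hY''.self_of_nhds, extVF_self]
  · rw [hZ''.self_of_nhds, extVF_self]

lemma riemannAt_eq (hX : SmoothVF X) (hY : SmoothVF Y) (hZ : SmoothVF Z) (x : M)
    (d : TangentSpace (𝓡 n) x) :
    riemannAt x (X x) (Y x) (Z x) d = inner ℝ (riemann X Y Z x) d := by
  rw [riemannAt, riemann_extVF hX hY hZ]

lemma isCurvatureLike_riemannAt (x : M) : IsCurvatureLike (riemannAt (n := n) x) where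
  swap a b c d := by
    obtain ⟨A, hA, rfl⟩ := exists_smoothVF_eq a
    obtain ⟨B, hB, rfl⟩ := exists_smoothVF_eq b
    obtain ⟨C, hC, rfl⟩ := exists_smoothVF_eq c
    rw [riemannAt_eq hA hB hC, riemannAt_eq hB hA hC, riemann_swap hA hB hC, inner_neg_left]
  pair a b c d := by
    obtain ⟨A, hA, rfl⟩ := exists_smoothVF_eq a
    obtain ⟨B, hB, rfl⟩ := exists_smoothVF_eq b
    obtain ⟨C, hC, rfl⟩ := exists_smoothVF_eq c
    obtain ⟨D, hD, rfl⟩ := exists_smoothVF_eq d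
    rw [riemannAt_eq hA hB hC, riemannAt_eq hC hD hA, inner_riemann_pair hA hB hC hD]
  add_right a b c d d' := inner_add_right _ _ _
  smul_right a b c r d := real_inner_smul_right _ _ _

lemma scalarCurv_eq_sum_riemannAt (x : M) :
    scalarCurv n x = ∑ i, ∑ j, riemannAt x (onb (n := n) x i) (onb (n := n) x j)
      (onb (n := n) x j) (onb (n := n) x i) :=
  Finset.sum_congr rfl fun i _ ↦ by rw [ricciOp, sum_inner]; rfl

end Curvature

/-! ### Contact metric structures and the tensor h -/

namespace AlmostContactMetric

variable {n : ℕ} {M : Type*} [TopologicalSpace M]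
  [ChartedSpace (EuclideanSpace ℝ (Fin n)) M] [IsManifold (𝓡 n) ∞ M]
  [RiemannianBundle (fun x : M ↦ TangentSpace (𝓡 n) x)] (S : AlmostContactMetric n M)

section Pointwise

variable (x : M) (v w : TangentSpace (𝓡 n) x)

lemma ξ_ne_zero : S.ξ x ≠ 0 := fun h ↦ by
  have := S.η_ξ x
  simp [h] at this

lemma φ_φ_ξ : S.φ x (S.φ x (S.ξ x)) = 0 := by
  rw [S.φ_φ, S.η_ξ, one_smul, neg_add_cancel]

/-- Since φ³ξ = 0, the formula for φ² at φξ gives φξ = tξ, and then φ²ξ = 0 forces t² = 0. -/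
lemma φ_ξ : S.φ x (S.ξ x) = 0 := by
  have h1 := S.φ_φ x (S.φ x (S.ξ x))
  rw [φ_φ_ξ, map_zero] at h1
  obtain ⟨t, ht⟩ : ∃ t : ℝ, S.φ x (S.ξ x) = t • S.ξ x :=
    ⟨_, (neg_add_eq_zero.1 h1.symm)⟩
  have h3 := S.φ_φ_ξ x
  rw [ht, map_smul, ht, smul_smul] at h3
  rw [ht, mul_self_eq_zero.1 ((smul_eq_zero.1 h3).resolve_right (S.ξ_ne_zero x)), zero_smul]

lemma η_eq_inner : S.η x v = inner ℝ (S.ξ x) v := by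
  have := S.inner_φ_φ x (S.ξ x) v
  rw [S.φ_ξ, inner_zero_left, S.η_ξ, one_mul] at this
  linarith

lemma η_φ : S.η x (S.φ x v) = 0 := by
  have h1 := S.φ_φ x (S.φ x v)
  have h2 : S.η x (S.φ x v) • S.ξ x = 0 := by
    rw [S.φ_φ x v, map_add, map_neg, map_smul, S.φ_ξ, smul_zero, add_zero] at h1
    simpa using h1.symm
  exact (smul_eq_zero.1 h2).resolve_right (S.ξ_ne_zero x)

lemma inner_φ_left : inner ℝ (S.φ x v) w = -inner ℝ v (S.φ x w) := by
  have := S.inner_φ_φ x v (S.φ x w)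
  rw [S.η_φ, mul_zero, sub_zero, S.φ_φ, inner_add_right, inner_neg_right,
    real_inner_smul_right, real_inner_comm (S.ξ x), ← S.η_eq_inner, S.η_φ] at this
  linarith

lemma norm_ξ : ‖S.ξ x‖ = 1 := by
  have h : ‖S.ξ x‖ ^ 2 = 1 := by
    rw [← real_inner_self_eq_norm_sq, ← S.η_eq_inner, S.η_ξ]
  nlinarith [norm_nonneg (S.ξ x)]

end Pointwise

variable {S} {X Y Z : Π x : M, TangentSpace (𝓡 n) x} {x : M}

lemma smoothVF_φF (hX : SmoothVF X) : SmoothVF (S.φF X) :=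
  ContMDiff.clm_bundle_apply (F₁ := EuclideanSpace ℝ (Fin n)) (F₂ := EuclideanSpace ℝ (Fin n))
    (E₁ := fun y : M ↦ TangentSpace (𝓡 n) y) (E₂ := fun y : M ↦ TangentSpace (𝓡 n) y)
    S.smooth_φ hX

lemma contMDiff_ηF (hX : SmoothVF X) : ContMDiff (𝓡 n) 𝓘(ℝ, ℝ) ∞ (S.ηF X) := by
  have := ContMDiff.clm_bundle_apply (F₁ := EuclideanSpace ℝ (Fin n)) (F₂ := ℝ)
    (E₁ := fun y : M ↦ TangentSpace (𝓡 n) y) (E₂ := Trivial M ℝ) S.smooth_η hX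
  intro x
  exact (contMDiffAt_totalSpace.1 (this x)).2

lemma two_smul_h (X : Π x : M, TangentSpace (𝓡 n) x) (x : M) : (2 : ℝ) • S.h X x =
    mlieBracket (𝓡 n) S.ξ (S.φF X) x - S.φ x (mlieBracket (𝓡 n) S.ξ X x) := by
  rw [h, smul_smul]
  norm_num

lemma h_ξ (x : M) : S.h S.ξ x = 0 := by
  have : S.φF S.ξ = 0 := funext S.φ_ξ
  simp [h, this]

/-- This is L_ξ η = 0: it follows from dη(ξ,X) = g(ξ,φX) = 0 and the constancy of η(ξ). -/
lemma ηF_mlieBracket_ξ (hS : S.IsContactMetric) (hX : SmoothVF X) (x : M) :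
    S.ηF (mlieBracket (𝓡 n) S.ξ X) x = dirDeriv S.ξ (S.ηF X) x := by
  have h1 := hS S.ξ X S.smooth_ξ hX x
  have h2 : S.ηF S.ξ = fun _ ↦ 1 := funext S.η_ξ
  rw [dη, h2, dirDeriv_const, φF, ← S.η_eq_inner, S.η_φ] at h1
  linarith

lemma η_h (hS : S.IsContactMetric) (hX : SmoothVF X) (x : M) : S.η x (S.h X x) = 0 := by
  have h1 := ηF_mlieBracket_ξ hS (smoothVF_φF (S := S) hX) x
  have h2 : S.ηF (S.φF X) = fun _ ↦ 0 := funext fun y ↦ S.η_φ y _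
  rw [h2, dirDeriv_const, ηF] at h1
  rw [h, map_smul, map_sub, h1, S.η_φ, sub_zero, smul_zero]

/-- L_ξ annihilates φ² = -1 + η ⊗ ξ because it annihilates η and ξ; hence φ and h anticommute. -/
lemma mlieBracket_ξ_φF_φF (hS : S.IsContactMetric) (hX : SmoothVF X) (x : M) :
    mlieBracket (𝓡 n) S.ξ (S.φF (S.φF X)) x = S.φ x (S.φ x (mlieBracket (𝓡 n) S.ξ X x)) := by
  have h1 : S.φF (S.φF X) = (-1 : ℝ) • X + S.ηF X • S.ξ := funext fun y ↦ by
    simp [φF, S.φ_φ, ηF]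
  rw [h1, mlieBracket_add_right ((hX.const_smul (-1)).mdifferentiableAt x)
    ((S.smooth_ξ.smul (contMDiff_ηF hX)).mdifferentiableAt x),
    mlieBracket_const_smul_right (hX.mdifferentiableAt x),
    mlieBracket_smul_right' ((contMDiff_ηF hX x).mdifferentiableAt (by simp))
      (S.smooth_ξ.mdifferentiableAt x), mlieBracket_self, S.φ_φ, ← ηF_mlieBracket_ξ hS hX, ηF]
  simp

lemma h_φF (hS : S.IsContactMetric) (hX : SmoothVF X) (x : M) :
    S.h (S.φF X) x = -S.φ x (S.h X x) := by
  rw [h, h, mlieBracket_ξ_φF_φF hS hX, map_smul, map_sub, ← smul_neg, neg_sub]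

lemma φ_φ_h (hS : S.IsContactMetric) (hX : SmoothVF X) (x : M) :
    S.φ x (S.φ x (S.h X x)) = -S.h X x := by
  rw [S.φ_φ, η_h hS hX, zero_smul, add_zero]

variable [IsContMDiffRiemannianBundle (𝓡 n) ∞ (EuclideanSpace ℝ (Fin n))
    (fun x : M ↦ TangentSpace (𝓡 n) x)] [T2Space M]

/-- The fundamental `2`-form `Φ = dη` is invariant under the flow of `ξ`. -/
lemma dirDeriv_ξ_inner_φF (hS : S.IsContactMetric) (hX : SmoothVF X) (hY : SmoothVF Y) (x : M) :
    dirDeriv S.ξ (fun y ↦ inner ℝ (X y) (S.φF Y y)) x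
      = inner ℝ (mlieBracket (𝓡 n) S.ξ X x) (S.φF Y x)
        + inner ℝ (X x) (S.φ x (mlieBracket (𝓡 n) S.ξ Y x)) := by
  have : IsManifold (𝓡 n) (minSmoothness ℝ 3) M := by
    simpa using (inferInstance : IsManifold (𝓡 n) 3 M)
  have h2 : minSmoothness ℝ 2 ≤ ∞ := by
    rw [minSmoothness_of_isRCLikeNormedField]; exact ENat.LEInfty.out
  have hξ := S.smooth_ξ
  have jac := leibniz_identity_mlieBracket_apply (I := 𝓡 n) (x := x)
    ((hξ x).of_le h2) ((hX x).of_le h2) ((hY x).of_le h2)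
  have md {f : M → ℝ} (hf : ContMDiff (𝓡 n) 𝓘(ℝ, ℝ) ∞ f) :
    MDifferentiableAt (𝓡 n) 𝓘(ℝ, ℝ) f x := (hf x).mdifferentiableAt (by simp)
  have hηX := contMDiff_ηF (S := S) hX
  have hηY := contMDiff_ηF (S := S) hY
  have hηXY := contMDiff_ηF (S := S) (hX.mlieBracket hY)
  -- Write Φ as dη: the claim becomes L_ξ dη = d(L_ξ η) = 0, where the Jacobi identity and the
  -- commutator formula for brackets let L_ξ pass through d.
  have e1 : (fun y ↦ inner ℝ (X y) (S.φF Y y)) = fun y ↦ (1 / 2 : ℝ) *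
      (dirDeriv X (S.ηF Y) y - dirDeriv Y (S.ηF X) y - S.ηF (mlieBracket (𝓡 n) X Y) y) :=
    funext fun y ↦ (hS X Y hX hY y).symm
  have e2 := hS _ Y (hξ.mlieBracket hX) hY x
  have e3 := hS X _ hX (hξ.mlieBracket hY) x
  have e4 {U : Π x : M, TangentSpace (𝓡 n) x} (hU : SmoothVF U) :
      S.ηF (mlieBracket (𝓡 n) S.ξ U) = dirDeriv S.ξ (S.ηF U) :=
    funext (ηF_mlieBracket_ξ hS hU)
  rw [dη, e4 hX, dirDeriv_mlieBracket hξ hX hηY] at e2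
  rw [dη, e4 hY, dirDeriv_mlieBracket hξ hY hηX] at e3
  have e5 := ηF_mlieBracket_ξ hS (hX.mlieBracket hY) x
  have e6 : S.ηF (mlieBracket (𝓡 n) (mlieBracket (𝓡 n) S.ξ X) Y) x
      + S.ηF (mlieBracket (𝓡 n) X (mlieBracket (𝓡 n) S.ξ Y)) x
      = dirDeriv S.ξ (S.ηF (mlieBracket (𝓡 n) X Y)) x := by
    rw [← e5]
    simp only [ηF, jac, map_add]
  change _ = _ + inner ℝ (X x) (S.φF _ x)
  rw [← e2, ← e3, e1, dirDeriv_mul (mdifferentiableAt_const)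
    (md (((hX.dirDeriv hηY).sub (hY.dirDeriv hηX)).sub hηXY)),
    dirDeriv_sub (md ((hX.dirDeriv hηY).sub (hY.dirDeriv hηX))) (md hηXY),
    dirDeriv_sub (md (hX.dirDeriv hηY)) (md (hY.dirDeriv hηX)), dirDeriv_const, ← e6]
  ring

/-- Φ(X,φY) = g(X,φ²Y) is symmetric in X and Y. Differentiating it along ξ in both orders, the
bracket terms match and only the terms in φh remain. -/
lemma inner_φ_h_comm (hS : S.IsContactMetric) (hX : SmoothVF X) (hY : SmoothVF Y) (x : M) :
    inner ℝ (S.φ x (S.h X x)) (Y x) = inner ℝ (X x) (S.φ x (S.h Y x)) := by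
  have c {U V : Π x : M, TangentSpace (𝓡 n) x} (hU : SmoothVF U) (hV : SmoothVF V) :
      dirDeriv S.ξ (fun y ↦ inner ℝ (U y) (S.φF (S.φF V) y)) x
        = inner ℝ (mlieBracket (𝓡 n) S.ξ U x) (S.φ x (S.φ x (V x)))
          + (inner ℝ (U x) (S.φ x ((2 : ℝ) • S.h V x))
          + inner ℝ (U x) (S.φ x (S.φ x (mlieBracket (𝓡 n) S.ξ V x)))) := by
    rw [dirDeriv_ξ_inner_φF hS hU (smoothVF_φF hV), two_smul_h, map_sub, inner_sub_right]
    simp only [φF]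
    ring
  have s (y : M) (v w : TangentSpace (𝓡 n) y) :
      inner ℝ v (S.φ y (S.φ y w)) = inner ℝ w (S.φ y (S.φ y v)) := by
    have h1 := S.inner_φ_left y v (S.φ y w)
    have h2 := S.inner_φ_left y w (S.φ y v)
    rw [real_inner_comm] at h2
    linarith
  have e : (fun y ↦ inner ℝ (X y) (S.φF (S.φF Y) y)) = fun y ↦ inner ℝ (Y y) (S.φF (S.φF X) y) :=
    funext fun y ↦ s y _ _
  have h1 := c hX hY
  have h2 := c hY hX
  rw [e, h2] at h1
  rw [s x (X x), s x (Y x) (mlieBracket (𝓡 n) S.ξ X x)] at h1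
  simp only [map_smul, real_inner_smul_right] at h1
  rw [real_inner_comm]
  linarith

lemma inner_h_comm (hS : S.IsContactMetric) (hX : SmoothVF X) (hY : SmoothVF Y) (x : M) :
    inner ℝ (S.h X x) (Y x) = inner ℝ (X x) (S.h Y x) := by
  have h1 := inner_φ_h_comm hS hX (smoothVF_φF (S := S) hY) x
  rw [h_φF hS hY, map_neg, φ_φ_h hS hY, neg_neg] at h1
  rw [← h1, φF, ← neg_neg (inner ℝ (S.φ x (S.h X x)) _), ← S.inner_φ_left, φ_φ_h hS hX,
    inner_neg_left, neg_neg]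

/-- The tensor `h` as a field of endomorphisms. -/
lemma exists_linearMap_h (hS : S.IsContactMetric) (x : M) :
    ∃ A : TangentSpace (𝓡 n) x →ₗ[ℝ] TangentSpace (𝓡 n) x,
      ∀ X : Π x : M, TangentSpace (𝓡 n) x, SmoothVF X → S.h X x = A (X x) := by
  -- By symmetry g(hX,Z) = g(X,hZ), whose right side depends linearly on the value of X at x alone;
  -- this gives linearity and independence of the extension at once.
  choose E hE hEx using fun v : TangentSpace (𝓡 n) x ↦ exists_smoothVF_eq v
  refine ⟨⟨⟨fun v ↦ S.h (E v) x, fun v w ↦ ?_⟩, fun r v ↦ ?_⟩, fun X hX ↦ ?_⟩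
  · refine eq_of_forall_inner_smoothVF fun Z hZ ↦ ?_
    simp only [inner_add_left, inner_h_comm hS (hE _) hZ, hEx]
  · refine eq_of_forall_inner_smoothVF fun Z hZ ↦ ?_
    simp only [real_inner_smul_left, inner_h_comm hS (hE _) hZ, hEx, RingHom.id_apply]
  · refine eq_of_forall_inner_smoothVF fun Z hZ ↦ ?_
    simp only [LinearMap.coe_mk, AddHom.coe_mk, inner_h_comm hS (hE _) hZ, hEx,
      inner_h_comm hS hX hZ]

end AlmostContactMetric

/-! ### Traces of h and φh, and the curvature formula -/

lemma sum_inner_apply_eq_zero_of_trace {V ι : Type*} [NormedAddCommGroup V]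
    [InnerProductSpace ℝ V] [Fintype ι] {A : V →ₗ[ℝ] V} (hA : LinearMap.trace ℝ V A = 0)
    (e : OrthonormalBasis ι ℝ V) : ∑ i, inner ℝ (A (e i)) (e i) = 0 := by
  rw [← hA, LinearMap.trace_eq_sum_inner A e]
  exact Finset.sum_congr rfl fun i _ ↦ real_inner_comm _ _

theorem theorem3p1 {M : Type*} [TopologicalSpace M] [T2Space M]
    [ChartedSpace (EuclideanSpace ℝ (Fin 3)) M] [IsManifold (𝓡 3) ∞ M]
    [RiemannianBundle (fun x : M ↦ TangentSpace (𝓡 3) x)]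
    [IsContMDiffRiemannianBundle (𝓡 3) ∞ (EuclideanSpace ℝ (Fin 3)) (fun x : M ↦ TangentSpace (𝓡 3) x)]
    (S : AlmostContactMetric 3 M) (κ μ ν : M → ℝ) (hS : S.IsKappaMuNu κ μ ν)
    (hκ : ∀ x, κ x < 1) (X Y Z : Π x : M, TangentSpace (𝓡 3) x)
    (hX : SmoothVF X) (hY : SmoothVF Y) (hZ : SmoothVF Z) (x : M) :
    riemann X Y Z x =
      (scalarCurv 3 x / 2 - 2 * κ x) • AlmostContactMetric.R₁ X Y Z x
      + (scalarCurv 3 x / 2 - 3 * κ x) • S.R₃ X Y Z x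
      + μ x • S.R₄ X Y Z x
      + ν x • S.R₇ X Y Z x := by
  have hc := hS.contact
  obtain ⟨A, hA⟩ := AlmostContactMetric.exists_linearMap_h hc x
  let φ : TangentSpace (𝓡 3) x →ₗ[ℝ] TangentSpace (𝓡 3) x := S.φ x
  have hAsymm (v w) : inner ℝ (A v) w = inner ℝ v (A w) := by
    obtain ⟨V, hV, rfl⟩ := exists_smoothVF_eq v
    obtain ⟨W, hW, rfl⟩ := exists_smoothVF_eq w
    rw [← hA V hV, ← hA W hW, AlmostContactMetric.inner_h_comm hc hV hW]
  have hBsymm (v w) : inner ℝ ((φ ∘ₗ A) v) w = inner ℝ v ((φ ∘ₗ A) w) := by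
    obtain ⟨V, hV, rfl⟩ := exists_smoothVF_eq v
    obtain ⟨W, hW, rfl⟩ := exists_smoothVF_eq w
    simp only [LinearMap.comp_apply, ← hA V hV, ← hA W hW]
    exact AlmostContactMetric.inner_φ_h_comm hc hV hW x
  have hAξ : A (S.ξ x) = 0 := by rw [← hA _ S.smooth_ξ, AlmostContactMetric.h_ξ]
  have hanti : A ∘ₗ φ = -(φ ∘ₗ A) := by
    ext1 v
    obtain ⟨V, hV, rfl⟩ := exists_smoothVF_eq v
    have := AlmostContactMetric.h_φF hc hV x
    rw [hA _ (AlmostContactMetric.smoothVF_φF hV), hA V hV] at this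
    exact this
  have hφφA : φ ∘ₗ (φ ∘ₗ A) = -A := by
    ext1 v
    obtain ⟨V, hV, rfl⟩ := exists_smoothVF_eq v
    have := AlmostContactMetric.φ_φ_h hc hV x
    rw [hA V hV] at this
    exact this
  have hBtr : LinearMap.trace ℝ _ (φ ∘ₗ A) = 0 := by
    have := LinearMap.trace_comp_comm' φ A
    rw [hanti, map_neg] at this
    linarith
  -- Here A = -φ(φA), while cyclicity and anticommutation give tr(φφA) = tr(φAφ) = -tr(φφA).
  have hAtr : LinearMap.trace ℝ _ A = 0 := by
    have := LinearMap.trace_comp_comm' φ (φ ∘ₗ A)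
    rw [LinearMap.comp_assoc, hanti, LinearMap.comp_neg, map_neg, hφφA, map_neg] at this
    linarith
  have hdim : Module.finrank ℝ (TangentSpace (𝓡 3) x) = 3 :=
    finrank_euclideanSpace_fin (𝕜 := ℝ) (n := 3)
  have hη (v) := S.η_eq_inner x v
  have hRξ (a b d) : riemannAt x a b (S.ξ x) d
      = κ x * (inner ℝ (S.ξ x) b * inner ℝ a d - inner ℝ (S.ξ x) a * inner ℝ b d)
        + μ x * (inner ℝ (S.ξ x) b * inner ℝ (A a) d - inner ℝ (S.ξ x) a * inner ℝ (A b) d)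
        + ν x * (inner ℝ (S.ξ x) b * inner ℝ ((φ ∘ₗ A) a) d
          - inner ℝ (S.ξ x) a * inner ℝ ((φ ∘ₗ A) b) d) := by
    obtain ⟨U, hU, rfl⟩ := exists_smoothVF_eq a
    obtain ⟨V, hV, rfl⟩ := exists_smoothVF_eq b
    rw [riemannAt_eq hU hV S.smooth_ξ, hS.riemann_ξ U V hU hV]
    simp only [AlmostContactMetric.φF, AlmostContactMetric.ηF, hA U hU, hA V hV, inner_add_left,
      inner_sub_left, real_inner_smul_left, hη]
    rfl
  refine ext_inner_right ℝ fun d ↦ ?_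
  rw [← riemannAt_eq hX hY hZ, (isCurvatureLike_riemannAt x).eq_of_reeb hdim (S.norm_ξ x) hAsymm
    hBsymm hAξ (by simp [hAξ]) (onb x) (sum_inner_apply_eq_zero_of_trace hAtr _)
    (sum_inner_apply_eq_zero_of_trace hBtr _) (scalarCurv_eq_sum_riemannAt x).symm hRξ]
  simp only [AlmostContactMetric.R₁, AlmostContactMetric.R₃, AlmostContactMetric.R₄,
    AlmostContactMetric.R₇, AlmostContactMetric.φF, AlmostContactMetric.ηF, hA X hX, hA Y hY,
    inner_add_left, inner_sub_left, real_inner_smul_left, hη, kulkarniNomizu]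
  rfl
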